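/- Let $(X,d)$ be a compact metric space and let $f\colon X\to X$ be continuous. A pair $(x,y)\in X\times X$ is a Li–Yorke pair of $f$ if $\liminf_{n\to\infty} d(f^n(x),f^n(y))=0$ and $\limsup_{n\to\infty} d(f^n(x),f^n(y))>0$, and $f$ is called densely chaotic if the set of its Li–Yorke pairs is dense in $X\times X$. Let $\mathcal K(X)$ be the space of all non-empty compact subsets of $X$ with the Hausdorff metric $d_H$ (again a compact metric space), and let $\overline f\colon\mathcal K(X)\to\mathcal K(X)$, $\overline f(K)=f(K)=\{f(x) : x\in K\}$, be the continuous map induced by $f$. **Theorem.** Let $I=[0,1]$ and let $f\colon I\to I$ be continuous. If $f$ is densely chaotic, then the induced map $\overline f\colon\mathcal K(I)\to\mathcal K(I)$ is densely chaotic. -/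

import Mathlib

open Filter Topology TopologicalSpace

/-- `C₁(f)`: the pairs `(x, y)` with `liminf d(fⁿ x, fⁿ y) = 0`. The space is compact, so the real
sequence is bounded and `liminf` and `limsup` have their usual meaning. -/
def proximalPairs {X : Type*} [MetricSpace X] [CompactSpace X] (f : C(X, X)) : Set (X × X) :=
  {p | liminf (fun n : ℕ => dist (f^[n] p.1) (f^[n] p.2)) atTop = 0}

/-- `C₂(f)`: the pairs `(x, y)` with `limsup d(fⁿ x, fⁿ y) > 0`. -/
def nonAsymptoticPairs {X : Type*} [MetricSpace X] [CompactSpace X] (f : C(X, X)) : Set (X × X) :=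
  {p | 0 < limsup (fun n : ℕ => dist (f^[n] p.1) (f^[n] p.2)) atTop}

/-- `C(f) = C₁(f) ∩ C₂(f)`: the set of Li–Yorke pairs of `f`. -/
def liYorkePairs {X : Type*} [MetricSpace X] [CompactSpace X] (f : C(X, X)) : Set (X × X) :=
  proximalPairs f ∩ nonAsymptoticPairs f

/-- `f` is densely chaotic if its Li–Yorke pairs are dense in `X × X`. -/
def DenselyChaotic {X : Type*} [MetricSpace X] [CompactSpace X] (f : C(X, X)) : Prop :=
  Dense (liYorkePairs f)

/-- The map `K ↦ f(K)` induced by `f` on the space of nonempty compact subsets of `X`, which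
carries the Hausdorff metric. -/
def inducedMap {X : Type*} [MetricSpace X] [CompactSpace X] (f : C(X, X)) :
    C(NonemptyCompacts X, NonemptyCompacts X) where
  toFun K := K.map f f.continuous
  continuous_toFun := f.continuous.nonemptyCompacts_map

/-
On a linear continuum, dense chaos of `f` forces a fixed point `z` such that `f^[n] '' J` comes
arbitrarily close to `z` for all large `n`, for every nondegenerate interval `J`: the ω-limit sets
of nondegenerate intervals are closed, invariant, order-connected and pairwise intersecting, so they
contain a common fixed point; covering relations between intervals show that it is approached not
only infinitely often but eventually.

Given finite sets `K` and `L`, suppose first that `f` is sensitive near one of their points `p`.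
Generic small perturbations of the points are then simultaneously close to `z` infinitely often,
while infinitely often the image of `p` is far from the images of all the others: the perturbed sets
form a Li–Yorke pair. Otherwise every point can be moved slightly to one whose orbit converges to
`z`, and adding the two points of a Li–Yorke pair of `f` to the perturbed sets, one to each, makes
them a Li–Yorke pair.
-/

section Iterates

theorem frequently_mul_of_frequently {P Q : ℕ → Prop} {p : ℕ} (hp : 0 < p)
    (hP : ∃ᶠ n in atTop, P n) (hPQ : ∀ n, P n → ∀ j < p, Q (j + n)) :
    ∃ᶠ k in atTop, Q (p * k) := by
  refine frequently_atTop.2 fun K => ?_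
  obtain ⟨n, hKn, hn⟩ := frequently_atTop.1 hP (p * K)
  have hmod : p * ((n + (p - 1)) / p) + (n + (p - 1)) % p = n + (p - 1) := Nat.div_add_mod _ _
  have hlt : (n + (p - 1)) % p < p := Nat.mod_lt _ hp
  refine ⟨(n + (p - 1)) / p, (Nat.le_div_iff_mul_le hp).2 (by rw [mul_comm]; omega), ?_⟩
  rw [show p * ((n + (p - 1)) / p) = (p - 1 - (n + (p - 1)) % p) + n by omega]
  exact hPQ n hn _ (by omega)

theorem eventually_of_eventually_mul {P Q : ℕ → Prop} {p : ℕ} (hp : 0 < p)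
    (hP : ∀ᶠ k in atTop, P (p * k)) (hPQ : ∀ n, P n → ∀ j < p, Q (j + n)) :
    ∀ᶠ n in atTop, Q n :=
  ((Nat.tendsto_div_const_atTop hp.ne').eventually hP).mono fun n hn =>
    Nat.mod_add_div n p ▸ hPQ _ hn _ (Nat.mod_lt n hp)

theorem subset_image_iterate_of_ge {X : Type*} {g : X → X} {S L : Set X} {r m : ℕ} (hr : 0 < r)
    (hS : S ⊆ g^[r] '' S) (hL : ∀ j < r, S ⊆ g^[j + m] '' L) {n : ℕ} (hn : m ≤ n) :
    S ⊆ g^[n] '' L := by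
  obtain ⟨j, rfl⟩ := Nat.exists_eq_add_of_le' hn
  induction j using Nat.strong_induction_on with
  | _ j ih =>
    rcases lt_or_ge j r with hj | hj
    · exact hL j hj
    · obtain ⟨i, rfl⟩ := Nat.exists_eq_add_of_le hj
      rw [add_assoc, Function.iterate_add, Set.image_comp]
      exact hS.trans (Set.image_mono (ih i (by omega) (by omega)))

variable {X : Type*} [TopologicalSpace X] {f : X → X} {z : X}

theorem eventually_forall_iterate_mem (hf : Continuous f) (hz : f z = z) {U : Set X}
    (hU : U ∈ 𝓝 z) (p : ℕ) : ∀ᶠ x in 𝓝 z, ∀ j < p, f^[j] x ∈ U :=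
  (eventually_all_finite (Set.finite_lt_nat p)).2 fun j _ =>
    (hf.iterate j).continuousAt <| by rwa [Function.iterate_fixed hz]

theorem mapsTo_omegaLimit_iterate (hf : Continuous f) (J : Set X) :
    Set.MapsTo f (omegaLimit atTop (Nat.iterate f) J) (omegaLimit atTop (Nat.iterate f) J) :=
  (mapsTo_omegaLimit (ϕ' := fun n => f^[n + 1]) J (Set.mapsTo_id J)
    (fun n x => (Function.iterate_succ_apply' f n x).symm) hf).mono_right
      (omegaLimit_subset_of_tendsto _ _ (tendsto_add_atTop_nat 1))

theorem mem_omegaLimit_iterate (hf : Continuous f) (hz : f z = z) {J : Set X} {p : ℕ} (hp : 0 < p)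
    (h : z ∈ omegaLimit atTop (Nat.iterate f) J) :
    z ∈ omegaLimit atTop (Nat.iterate f^[p]) J := by
  rw [mem_omegaLimit_iff_frequently] at h ⊢
  intro U hU
  simp only [← Function.iterate_mul]
  refine frequently_mul_of_frequently (Q := fun n => (J ∩ f^[n] ⁻¹' U).Nonempty) hp
    (h _ (eventually_forall_iterate_mem hf hz hU p)) ?_
  rintro n ⟨x, hx, hxU⟩ j hj
  exact ⟨x, hx, by simpa only [Set.mem_preimage, Function.iterate_add_apply] using hxU j hj⟩

/-- The lower Kuratowski limit of the images `f^[n] '' J`: the points every neighbourhood of which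
meets all but finitely many of them. Their upper limit is `omegaLimit atTop (Nat.iterate f) J`. -/
def lowerLimit (f : X → X) (J : Set X) : Set X :=
  {z | ∀ U ∈ 𝓝 z, ∀ᶠ n in atTop, (J ∩ f^[n] ⁻¹' U).Nonempty}

theorem lowerLimit_mono {J K : Set X} (h : J ⊆ K) : lowerLimit f J ⊆ lowerLimit f K :=
  fun _ hz U hU => (hz U hU).mono fun _ => .mono (Set.inter_subset_inter_left _ h)

theorem mem_lowerLimit_of_mem_image_iterate (hz : f z = z) {J : Set X} {m : ℕ}
    (hm : z ∈ f^[m] '' J) : z ∈ lowerLimit f J := by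
  obtain ⟨x, hx, hxz⟩ := hm
  intro U hU
  filter_upwards [eventually_ge_atTop m] with n hn
  refine ⟨x, hx, ?_⟩
  rw [Set.mem_preimage, ← Nat.sub_add_cancel hn, Function.iterate_add_apply, hxz,
    Function.iterate_fixed hz]
  exact mem_of_mem_nhds hU

theorem mem_lowerLimit_of_iterate (hf : Continuous f) (hz : f z = z) {J : Set X} {p : ℕ}
    (hp : 0 < p) (m : ℕ) (h : z ∈ lowerLimit f^[p] (f^[m] '' J)) : z ∈ lowerLimit f J := by
  intro U hU
  rw [← map_add_atTop_eq_nat m, eventually_map]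
  have hV := h _ (eventually_forall_iterate_mem hf hz hU p)
  simp only [← Function.iterate_mul] at hV
  refine eventually_of_eventually_mul
    (P := fun n => (f^[m] '' J ∩ f^[n] ⁻¹' {x | ∀ j < p, f^[j] x ∈ U}).Nonempty) hp hV ?_
  rintro n ⟨_, ⟨x, hx, rfl⟩, hxU⟩ j hj
  exact ⟨x, hx, by simpa only [Set.mem_preimage, Function.iterate_add_apply] using hxU j hj⟩

theorem isPreconnected_iUnion_image_iterate (hf : Continuous f) {L : Set X} (hL : IsPreconnected L)
    (hfL : (L ∩ f '' L).Nonempty) : IsPreconnected (⋃ k, f^[k] '' L) := by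
  refine IsPreconnected.iUnion_of_chain (fun k => hL.image _ (hf.iterate k).continuousOn)
    fun k => ?_
  obtain ⟨_, hx, x, hxL, rfl⟩ := hfL
  exact ⟨f^[k] (f x), ⟨f x, hx, rfl⟩, x, hxL, rfl⟩

end Iterates

section Pairs

variable {X : Type*} [MetricSpace X] [CompactSpace X] {f : C(X, X)}

theorem mem_proximalPairs_iff {q : X × X} :
    q ∈ proximalPairs f ↔ ∀ ε > 0, ∃ᶠ n in atTop, dist (f^[n] q.1) (f^[n] q.2) < ε := by
  have hle : IsBoundedUnder (· ≤ ·) atTop (fun n : ℕ => dist (f^[n] q.1) (f^[n] q.2)) :=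
    isBoundedUnder_of ⟨_, fun n => Metric.dist_le_diam_of_mem isCompact_univ.isBounded
      (Set.mem_univ _) (Set.mem_univ _)⟩
  refine ⟨fun h ε hε => frequently_lt_of_liminf_lt hle.isCoboundedUnder_ge (h.trans_lt hε),
    fun h => le_antisymm (le_of_forall_gt_imp_ge_of_dense fun ε hε => ?_)
      (le_liminf_of_le hle.isCoboundedUnder_ge (.of_forall fun _ => dist_nonneg))⟩
  exact liminf_le_of_frequently_le ((h ε hε).mono fun _ => le_of_lt)
    (isBoundedUnder_of ⟨0, fun _ => dist_nonneg⟩)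

theorem mem_nonAsymptoticPairs_iff {q : X × X} :
    q ∈ nonAsymptoticPairs f ↔ ∃ ε > 0, ∃ᶠ n in atTop, ε < dist (f^[n] q.1) (f^[n] q.2) := by
  have hge : IsBoundedUnder (· ≥ ·) atTop (fun n : ℕ => dist (f^[n] q.1) (f^[n] q.2)) :=
    isBoundedUnder_of ⟨0, fun _ => dist_nonneg⟩
  refine ⟨fun h => ?_, fun ⟨ε, hε, h⟩ => hε.trans_le ?_⟩
  · obtain ⟨ε, hε, hlt⟩ := exists_between (Set.mem_ofPred_eq ▸ h : _ < limsup _ _)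
    exact ⟨ε, hε, frequently_lt_of_lt_limsup hge.isCoboundedUnder_le hlt⟩
  · exact le_limsup_of_frequently_le (h.mono fun _ => le_of_lt)
      (isBoundedUnder_of ⟨_, fun n => Metric.dist_le_diam_of_mem isCompact_univ.isBounded
        (Set.mem_univ _) (Set.mem_univ _)⟩)

theorem mem_proximalPairs_iterate {q : X × X} (hq : q ∈ proximalPairs f) {p : ℕ} (hp : 0 < p) :
    q ∈ proximalPairs ⟨f^[p], f.continuous.iterate p⟩ := by
  rw [mem_proximalPairs_iff] at hq ⊢
  intro ε hε
  have huc : ∀ᶠ r : X × X in uniformity X, ∀ j < p, dist (f^[j] r.1) (f^[j] r.2) < ε :=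
    (eventually_all_finite (Set.finite_lt_nat p)).2 fun j _ =>
      CompactSpace.uniformContinuous_of_continuous (f.continuous.iterate j)
        (Metric.dist_mem_uniformity hε)
  obtain ⟨η, hη, h⟩ := Metric.mem_uniformity_dist.1 huc
  simp only [ContinuousMap.coe_mk, ← Function.iterate_mul]
  refine frequently_mul_of_frequently (Q := fun n => dist (f^[n] q.1) (f^[n] q.2) < ε) hp
    (hq η hη) fun n hn j hj => ?_
  simpa only [Function.iterate_add_apply] using h hn j hj

theorem omegaLimit_inter_nonempty_of_mem_proximalPairs {x y : X} (hxy : (x, y) ∈ proximalPairs f)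
    {J K : Set X} (hx : x ∈ J) (hy : y ∈ K) :
    (omegaLimit atTop (Nat.iterate f) J ∩ omegaLimit atTop (Nat.iterate f) K).Nonempty := by
  have hcluster : MapClusterPt 0 atTop fun n => dist (f^[n] x) (f^[n] y) :=
    Metric.nhds_basis_ball.mapClusterPt_iff_frequently.2 fun ε hε =>
      (mem_proximalPairs_iff.1 hxy ε hε).mono fun n hn => by
        rwa [mem_ball_zero_iff, Real.norm_of_nonneg dist_nonneg]
  obtain ⟨φ, hφ, hdist⟩ := hcluster.tendsto_subseq
  obtain ⟨a, ψ, hψ, hxa⟩ := CompactSpace.tendsto_subseq fun k => f^[φ k] x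
  have hya : Tendsto (fun k => f^[φ (ψ k)] y) atTop (𝓝 a) :=
    (tendsto_iff_of_dist (hdist.comp hψ.tendsto_atTop)).1 hxa
  have hmem : ∀ {v : X} {S : Set X}, v ∈ S → Tendsto (fun k => f^[φ (ψ k)] v) atTop (𝓝 a) →
      a ∈ omegaLimit atTop (Nat.iterate f) S := fun hv ha =>
    omegaLimit_mono_right _ _ (Set.singleton_subset_iff.2 hv)
      ((mem_omegaLimit_singleton_iff_mapClusterPt ..).2
        (ha.mapClusterPt.of_comp (hφ.comp hψ).tendsto_atTop))
  exact ⟨a, hmem hx hxa, hmem hy hya⟩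

theorem DenselyChaotic.nontrivial [Nonempty X] (hf : DenselyChaotic f) : Nontrivial X := by
  obtain ⟨⟨a, b⟩, hab⟩ := hf.nonempty
  obtain ⟨ε, hε, hfar⟩ := mem_nonAsymptoticPairs_iff.1 hab.2
  obtain ⟨n, hn⟩ := hfar.exists
  exact ⟨_, _, dist_pos.1 (hε.trans hn)⟩

end Pairs

/-- The intervals with more than one point. On the line the connected sets are the intervals, and
this formulation does not mention the order, so it applies verbatim to `Xᵒᵈ`. -/
structure IsNondegenerateInterval {X : Type*} [TopologicalSpace X] (J : Set X) : Prop where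
  isPreconnected : IsPreconnected J
  nontrivial : J.Nontrivial

section IntervalImages

variable {X : Type*} [LinearOrder X]

theorem IsNondegenerateInterval.nonempty_interior [DenselyOrdered X] [TopologicalSpace X]
    [OrderTopology X] {J : Set X} (hJ : IsNondegenerateInterval J) : (interior J).Nonempty := by
  obtain ⟨a, ha, b, hb, hab⟩ := hJ.nontrivial.exists_lt
  exact (Set.nonempty_Ioo.2 hab).mono <| interior_maximal
    (Set.Ioo_subset_Icc_self.trans (hJ.isPreconnected.ordConnected.out ha hb)) isOpen_Ioo

theorem exists_eventually_mem_uIcc [DenselyOrdered X] [TopologicalSpace X] [OrderClosedTopology X]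
    {u v : X} (h : u ≠ v) : ∃ c, ∀ᶠ q : X × X in 𝓝 (u, v), c ∈ Set.uIcc q.1 q.2 := by
  rcases h.lt_or_gt with h | h
  · obtain ⟨c, huc, hcv⟩ := exists_between h
    refine ⟨c, ?_⟩
    filter_upwards [prod_mem_nhds (Iio_mem_nhds huc) (Ioi_mem_nhds hcv)] with q ⟨h₁, h₂⟩
    exact Set.mem_uIcc_of_le (le_of_lt h₁) (le_of_lt h₂)
  · obtain ⟨c, hvc, hcu⟩ := exists_between h
    refine ⟨c, ?_⟩
    filter_upwards [prod_mem_nhds (Ioi_mem_nhds hcu) (Iio_mem_nhds hvc)] with q ⟨h₁, h₂⟩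
    exact Set.mem_uIcc_of_ge (le_of_lt h₂) (le_of_lt h₁)

variable [DenselyOrdered X] [MetricSpace X] [OrderTopology X] [CompactSpace X] {f : C(X, X)}
  {J K : Set X}

theorem exists_frequently_mem_image_iterate (hJ : IsPreconnected J) {x y : X}
    (hxy : (x, y) ∈ nonAsymptoticPairs f) (hx : x ∈ J) (hy : y ∈ J) :
    ∃ c, ∃ᶠ n in atTop, c ∈ f^[n] '' J := by
  obtain ⟨ε, hε, hfar⟩ := mem_nonAsymptoticPairs_iff.1 hxy
  have hclosed : IsClosed {q : X × X | ε ≤ dist q.1 q.2} :=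
    isClosed_le continuous_const (continuous_fst.dist continuous_snd)
  obtain ⟨⟨u, v⟩, huv, hcluster⟩ := hclosed.isCompact.exists_mapClusterPt_of_frequently
    (f := fun n : ℕ => (f^[n] x, f^[n] y)) (hfar.mono fun _ => le_of_lt)
  obtain ⟨c, hc⟩ := exists_eventually_mem_uIcc (dist_pos.1 (hε.trans_le huv))
  exact ⟨c, (hcluster.frequently hc).mono fun n hn =>
    (hJ.image _ (f.continuous.iterate n).continuousOn).ordConnected.uIcc_subset
      (Set.mem_image_of_mem _ hx) (Set.mem_image_of_mem _ hy) hn⟩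

namespace DenselyChaotic

theorem exists_mem_liYorkePairs (hf : DenselyChaotic f) (hJ : IsNondegenerateInterval J)
    (hK : IsNondegenerateInterval K) :
    ∃ x ∈ J, ∃ y ∈ K, (x, y) ∈ liYorkePairs f := by
  obtain ⟨⟨x, y⟩, ⟨hx, hy⟩, hxy⟩ := hf.inter_open_nonempty _
    (isOpen_interior.prod isOpen_interior) (hJ.nonempty_interior.prod hK.nonempty_interior)
  exact ⟨x, interior_subset hx, y, interior_subset hy, hxy⟩

theorem image_iterate (hf : DenselyChaotic f) (hJ : IsNondegenerateInterval J) (n : ℕ) :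
    IsNondegenerateInterval (f^[n] '' J) := by
  refine ⟨hJ.isPreconnected.image _ (f.continuous.iterate n).continuousOn, ?_⟩
  obtain ⟨x, hx, y, hy, hxy⟩ := hf.exists_mem_liYorkePairs hJ hJ
  obtain ⟨ε, hε, hfar⟩ := mem_nonAsymptoticPairs_iff.1 hxy.2
  refine ⟨_, Set.mem_image_of_mem _ hx, _, Set.mem_image_of_mem _ hy, fun heq => ?_⟩
  obtain ⟨m, hnm, hm⟩ := frequently_atTop.1 hfar n
  rw [← Nat.sub_add_cancel hnm, Function.iterate_add_apply, Function.iterate_add_apply, heq,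
    dist_self] at hm
  exact hε.not_gt hm

theorem omegaLimit_inter_nonempty (hf : DenselyChaotic f) (hJ : IsNondegenerateInterval J)
    (hK : IsNondegenerateInterval K) {p : ℕ} (hp : 0 < p) :
    (omegaLimit atTop (Nat.iterate f^[p]) J ∩ omegaLimit atTop (Nat.iterate f^[p]) K).Nonempty := by
  obtain ⟨x, hx, y, hy, hxy⟩ := hf.exists_mem_liYorkePairs hJ hK
  exact omegaLimit_inter_nonempty_of_mem_proximalPairs (mem_proximalPairs_iterate hxy.1 hp) hx hy

theorem exists_image_iterate_inter_nonempty (hf : DenselyChaotic f)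
    (hJ : IsNondegenerateInterval J) (N : ℕ) :
    ∃ n ≥ N, ∃ p > 0, (f^[n] '' J ∩ f^[p] '' (f^[n] '' J)).Nonempty := by
  obtain ⟨x, hx, y, hy, hxy⟩ := hf.exists_mem_liYorkePairs hJ hJ
  obtain ⟨c, hc⟩ := exists_frequently_mem_image_iterate hJ.isPreconnected hxy.2 hx hy
  obtain ⟨n, hNn, hn⟩ := frequently_atTop.1 hc N
  obtain ⟨m, hnm, hm⟩ := frequently_atTop.1 hc (n + 1)
  refine ⟨n, hNn, m - n, by omega, c, hn, ?_⟩
  rwa [← Set.image_comp, ← Function.iterate_add, Nat.sub_add_cancel (by omega)]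

theorem isPreconnected_closure_image2_iterate_Ici (hf : DenselyChaotic f)
    (hJ : IsNondegenerateInterval J) {n p : ℕ} (hp : 0 < p)
    (hmeet : (f^[n] '' J ∩ f^[p] '' (f^[n] '' J)).Nonempty) :
    IsPreconnected (closure (Set.image2 (Nat.iterate f) (Set.Ici n) J)) := by
  let U : ℕ → Set X := fun i => ⋃ k, (f^[p])^[k] '' (f^[i] '' J)
  have hUpre : ∀ i ∈ Set.Ici n, IsPreconnected (closure (U i)) := by
    refine fun i hi => (isPreconnected_iUnion_image_iterate (f.continuous.iterate p)
      (hf.image_iterate hJ i).isPreconnected ?_).closure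
    obtain ⟨_, ⟨x, hx, rfl⟩, _, ⟨y, hy, rfl⟩, hyx⟩ := hmeet
    refine ⟨f^[i] x, Set.mem_image_of_mem _ hx, f^[i] y, Set.mem_image_of_mem _ hy, ?_⟩
    rw [← Nat.sub_add_cancel hi, Function.iterate_add_apply, Function.iterate_add_apply, ← hyx,
      ← Function.iterate_add_apply, add_comm, Function.iterate_add_apply]
  have hωU : ∀ i, omegaLimit atTop (Nat.iterate f^[p]) (f^[i] '' J) ⊆ closure (U i) := fun i =>
    (omegaLimit_subset_closure_image2 _ _ _ univ_mem).trans <| closure_mono <|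
      Set.image2_subset_iff.2 fun k _ x hx => Set.mem_iUnion.2 ⟨k, Set.mem_image_of_mem _ hx⟩
  have hUmeet : ∀ i j, (closure (U i) ∩ closure (U j)).Nonempty := fun i j =>
    (hf.omegaLimit_inter_nonempty (hf.image_iterate hJ i) (hf.image_iterate hJ j) hp).mono
      (Set.inter_subset_inter (hωU i) (hωU j))
  refine (IsPreconnected.biUnion_of_reflTransGen hUpre fun i hi j _ =>
    .single ⟨hUmeet i j, hi⟩).subset_closure (Set.iUnion₂_subset fun i hi => closure_mono ?_)
    (closure_mono ?_)
  · refine Set.iUnion_subset fun k => ?_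
    rintro _ ⟨_, ⟨x, hx, rfl⟩, rfl⟩
    rw [← Function.iterate_mul, ← Function.iterate_add_apply]
    exact Set.mem_image2_of_mem (Set.mem_Ici.2 (le_add_left hi)) hx
  · refine Set.image2_subset_iff.2 fun i hi x hx => Set.mem_iUnion₂.2 ⟨i, hi, subset_closure ?_⟩
    exact Set.mem_iUnion.2 ⟨0, _, Set.mem_image_of_mem _ hx, rfl⟩

theorem ordConnected_omegaLimit (hf : DenselyChaotic f) (hJ : IsNondegenerateInterval J) :
    (omegaLimit atTop (Nat.iterate f) J).OrdConnected := by
  refine ⟨fun a ha b hb y hy => Set.mem_iInter₂.2 fun u hu => ?_⟩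
  obtain ⟨N, hN⟩ := mem_atTop_sets.1 hu
  obtain ⟨n, hNn, p, hp, hmeet⟩ := hf.exists_image_iterate_inter_nonempty hJ N
  have hclosure := omegaLimit_subset_closure_image2 atTop (Nat.iterate f) J (Ici_mem_atTop n)
  refine closure_mono (Set.image2_subset_right fun m hm => hN m (hNn.trans hm)) ?_
  exact (hf.isPreconnected_closure_image2_iterate_Ici hJ hp hmeet).ordConnected.out
    (hclosure ha) (hclosure hb) hy

end DenselyChaotic

end IntervalImages

section FixedPoint

theorem forall_lt_self_or_forall_self_lt {X : Type*} [LinearOrder X] [TopologicalSpace X]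
    [OrderClosedTopology X] {g : X → X} (hg : Continuous g) {U : Set X}
    (hU : IsPreconnected U) (hne : ∀ y ∈ U, g y ≠ y) :
    (∀ y ∈ U, g y < y) ∨ ∀ y ∈ U, y < g y := by
  by_contra! ⟨⟨u, hu, hgu⟩, v, hv, hgv⟩
  obtain ⟨y, hy, hgy⟩ := hU.intermediate_value₂ hv hu hg.continuousOn continuousOn_id hgv hgu
  exact hne y hy hgy

variable {X : Type*} [CompleteLinearOrder X] [TopologicalSpace X] [OrderTopology X]
  [DenselyOrdered X] {g : X → X} {z : X}

theorem exists_isFixedPt_forall_mem (hg : Continuous g) {ι : Type*} {D : ι → Set X}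
    (hclosed : ∀ i, IsClosed (D i)) (hconn : ∀ i, (D i).OrdConnected)
    (hmaps : ∀ i, Set.MapsTo g (D i) (D i)) (hmeet : ∀ i j, (D i ∩ D j).Nonempty) :
    ∃ z, g z = z ∧ ∀ i, z ∈ D i := by
  have hne : ∀ i, (D i).Nonempty := fun i => (hmeet i i).left
  have hle : ⨆ i, sInf (D i) ≤ ⨅ j, sSup (D j) := iSup_le fun i => le_iInf fun j =>
    let ⟨_, hxi, hxj⟩ := hmeet i j
    (sInf_le hxi).trans (le_sSup hxj)
  have hsub : ∀ x ∈ Set.Icc (⨆ i, sInf (D i)) (⨅ j, sSup (D j)), ∀ i, x ∈ D i := fun x hx i =>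
    (hconn i).out ((hclosed i).sInf_mem (hne i)) ((hclosed i).sSup_mem (hne i))
      ⟨(le_iSup (fun i => sInf (D i)) i).trans hx.1, hx.2.trans (iInf_le (fun i => sSup (D i)) i)⟩
  obtain ⟨z, hz, hgz⟩ := exists_mem_Icc_isFixedPt_of_mapsTo (f := g) hg.continuousOn hle
    fun x hx => ⟨iSup_le fun i => sInf_le (hmaps i (hsub x hx i)),
      le_iInf fun i => le_sSup (hmaps i (hsub x hx i))⟩
  exact ⟨z, hgz, hsub z hz⟩

theorem exists_Icc_subset_image_iterate (hg : Continuous g)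
    (hω : ∀ J, IsNondegenerateInterval J → z ∈ omegaLimit atTop (Nat.iterate g) J) {d w : X}
    (hzd : z < d) (hdw : d < w) (hw : g w = w) :
    ∃ r > 0, Set.Icc d w ⊆ g^[r] '' Set.Icc d w := by
  have hJ : IsNondegenerateInterval (Set.Icc d w) :=
    ⟨isPreconnected_Icc, d, Set.left_mem_Icc.2 hdw.le, w, Set.right_mem_Icc.2 hdw.le, hdw.ne⟩
  obtain ⟨r, hr, x, hx, hxd⟩ := frequently_atTop.1
    ((mem_omegaLimit_iff_frequently ..).1 (hω _ hJ) _ (Iio_mem_nhds hzd)) 1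
  refine ⟨r, hr, (Set.Icc_subset_Icc_left (le_of_lt hxd)).trans ?_⟩
  exact (isPreconnected_Icc.image _ (hg.iterate r).continuousOn).ordConnected.out
    (Set.mem_image_of_mem _ hx) ⟨w, Set.right_mem_Icc.2 hdw.le, Function.iterate_fixed hw r⟩

theorem mem_lowerLimit_of_isFixedPt_mem_image (hg : Continuous g) (hz : g z = z)
    (hω : ∀ J, IsNondegenerateInterval J → z ∈ omegaLimit atTop (Nat.iterate g) J) {L : Set X}
    (hL : IsNondegenerateInterval L) (hzL : ∀ k, ∀ x ∈ L, z < g^[k] x) {w : X} (hw : g w = w)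
    {k : ℕ} (hwk : w ∈ g^[k] '' L) : z ∈ lowerLimit g L := by
  have hzw : z < w := by
    obtain ⟨x, hx, rfl⟩ := hwk
    exact hzL k x hx
  have hwn : ∀ n ≥ k, w ∈ g^[n] '' L := by
    obtain ⟨x, hx, hxw⟩ := hwk
    refine fun n hn => ⟨x, hx, ?_⟩
    rw [← Nat.sub_add_cancel hn, Function.iterate_add_apply, hxw, Function.iterate_fixed hw]
  intro U hU
  obtain ⟨c, hzc, hcU⟩ := exists_Ico_subset_of_mem_nhds hU ⟨w, hzw⟩
  obtain ⟨d, hzd, hd⟩ := exists_between (lt_min hzc hzw)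
  obtain ⟨hdc, hdw⟩ := lt_min_iff.1 hd
  obtain ⟨r, hr, hcover⟩ := exists_Icc_subset_image_iterate hg hω hzd hdw hw
  -- An image of `L` which comes close to `z` keeps covering `[d, w]` during the next `r` steps.
  obtain ⟨m, hkm, x, hx, hxd⟩ := frequently_atTop.1
    ((mem_omegaLimit_iff_frequently ..).1 (hω L hL) _
      (eventually_forall_iterate_mem hg hz (Iio_mem_nhds hzd) r)) k
  have hcoverL : ∀ j < r, Set.Icc d w ⊆ g^[j + m] '' L := fun j hj =>
    (Set.Icc_subset_Icc_left (le_of_lt (hxd j hj))).trans <|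
      (hL.isPreconnected.image _ (hg.iterate _).continuousOn).ordConnected.out
        ⟨x, hx, Function.iterate_add_apply ..⟩ (hwn _ (le_add_left hkm))
  filter_upwards [eventually_ge_atTop m] with n hn
  obtain ⟨y, hy, hyd⟩ :=
    subset_image_iterate_of_ge hr hcover hcoverL hn (Set.left_mem_Icc.2 hdw.le)
  exact ⟨y, hy, hcU ⟨(hzL n y hy).le, hyd ▸ hdc⟩⟩

theorem mem_lowerLimit_of_forall_lt (hg : Continuous g) (hz : g z = z)
    (hω : ∀ J, IsNondegenerateInterval J → z ∈ omegaLimit atTop (Nat.iterate g) J) {L : Set X}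
    (hL : IsNondegenerateInterval L) (hgL : (L ∩ g '' L).Nonempty)
    (hzL : ∀ k, ∀ x ∈ L, z < g^[k] x) : z ∈ lowerLimit g L := by
  by_cases hfix : ∃ k, ∃ w ∈ g^[k] '' L, g w = w
  · obtain ⟨k, w, hwk, hw⟩ := hfix
    exact mem_lowerLimit_of_isFixedPt_mem_image hg hz hω hL hzL hw hwk
  push Not at hfix
  have hmem : ∀ k, ∀ x ∈ L, g^[k] x ∈ ⋃ k, g^[k] '' L := fun k x hx =>
    Set.mem_iUnion.2 ⟨k, Set.mem_image_of_mem _ hx⟩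
  rcases forall_lt_self_or_forall_self_lt hg
    (isPreconnected_iUnion_image_iterate hg hL.isPreconnected hgL) fun y hy =>
      let ⟨k, hk⟩ := Set.mem_iUnion.1 hy
      hfix k y hk with hdecr | hincr
  · intro U hU
    obtain ⟨x₀, hx₀⟩ := hL.nontrivial.nonempty
    obtain ⟨c, hzc, hcU⟩ := exists_Ico_subset_of_mem_nhds hU ⟨x₀, hzL 0 x₀ hx₀⟩
    obtain ⟨k, x, hx, hxc⟩ :=
      ((mem_omegaLimit_iff_frequently ..).1 (hω L hL) _ (Iio_mem_nhds hzc)).exists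
    have hanti : Antitone fun n => g^[n] x := antitone_nat_of_succ_le fun n => by
      rw [Function.iterate_succ_apply']
      exact (hdecr _ (hmem n x hx)).le
    filter_upwards [eventually_ge_atTop k] with n hn
    exact ⟨x, hx, hcU ⟨(hzL n x hx).le, (hanti hn).trans_lt hxc⟩⟩
  · exfalso
    obtain ⟨a, ha, b, hb, hab⟩ := hL.nontrivial.exists_lt
    have hLa : IsNondegenerateInterval (L ∩ Set.Ici a) :=
      ⟨(hL.isPreconnected.ordConnected.inter Set.ordConnected_Ici).isPreconnected,
        a, ⟨ha, le_rfl⟩, b, ⟨hb, hab.le⟩, hab.ne⟩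
    obtain ⟨k, x, ⟨hx, hax⟩, hxa⟩ :=
      ((mem_omegaLimit_iff_frequently ..).1 (hω _ hLa) _ (Iio_mem_nhds (hzL 0 a ha))).exists
    have hmono : Monotone fun n => g^[n] x := monotone_nat_of_le_succ fun n => by
      rw [Function.iterate_succ_apply']
      exact (hincr _ (hmem n x hx)).le
    exact (hax.trans (hmono k.zero_le)).not_gt hxa

theorem mem_lowerLimit_of_forall_mem_omegaLimit (hg : Continuous g) (hz : g z = z)
    (hω : ∀ J, IsNondegenerateInterval J → z ∈ omegaLimit atTop (Nat.iterate g) J) {L : Set X}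
    (hL : IsNondegenerateInterval L) (hgL : (L ∩ g '' L).Nonempty) : z ∈ lowerLimit g L := by
  by_cases hzU : z ∈ ⋃ k, g^[k] '' L
  · obtain ⟨k, hk⟩ := Set.mem_iUnion.1 hzU
    exact mem_lowerLimit_of_mem_image_iterate hz hk
  have hmem : ∀ k, ∀ x ∈ L, g^[k] x ∈ ⋃ k, g^[k] '' L := fun k x hx =>
    Set.mem_iUnion.2 ⟨k, Set.mem_image_of_mem _ hx⟩
  rcases (isPreconnected_iUnion_image_iterate hg hL.isPreconnected hgL).subset_or_subset
    isOpen_Iio isOpen_Ioi (Set.Iio_disjoint_Ioi_same (a := z)) fun y hy =>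
      lt_or_gt_of_ne (ne_of_mem_of_not_mem hy hzU) with hlt | hgt
  · exact mem_lowerLimit_of_forall_lt (X := Xᵒᵈ) hg hz hω hL hgL fun k x hx => hlt (hmem k x hx)
  · exact mem_lowerLimit_of_forall_lt hg hz hω hL hgL fun k x hx => hgt (hmem k x hx)

end FixedPoint

theorem DenselyChaotic.exists_isFixedPt_forall_mem_lowerLimit {X : Type*} [CompleteLinearOrder X]
    [MetricSpace X] [OrderTopology X] [DenselyOrdered X] {f : C(X, X)} (hf : DenselyChaotic f) :
    ∃ z, f z = z ∧ ∀ J, IsNondegenerateInterval J → z ∈ lowerLimit f J := by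
  obtain ⟨z, hz, hω⟩ := exists_isFixedPt_forall_mem f.continuous
    (ι := {J : Set X // IsNondegenerateInterval J})
    (D := fun J => omegaLimit atTop (Nat.iterate f) J) (fun J => isClosed_omegaLimit ..)
    (fun J => hf.ordConnected_omegaLimit J.2)
    (fun J => mapsTo_omegaLimit_iterate f.continuous J)
    (fun J K => by simpa using hf.omegaLimit_inter_nonempty J.2 K.2 one_pos)
  refine ⟨z, hz, fun J hJ => ?_⟩
  obtain ⟨n, -, p, hp, hmeet⟩ := hf.exists_image_iterate_inter_nonempty hJ 0
  refine mem_lowerLimit_of_iterate f.continuous hz hp n ?_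
  exact mem_lowerLimit_of_forall_mem_omegaLimit (f.continuous.iterate p)
    (Function.iterate_fixed hz p) (fun K hK => mem_omegaLimit_iterate f.continuous hz hp
      (hω ⟨K, hK⟩)) (hf.image_iterate hJ n) hmeet

section Residual

variable {Y : Type*} [TopologicalSpace Y] {V : Set Y}

theorem eventually_residual_mem_imp_mem {W : Set Y} (hW : IsOpen W) (hVW : V ⊆ closure W) :
    ∀ᶠ y in residual Y, y ∈ V → y ∈ W := by
  have hdense : Dense (frontier W)ᶜ := by
    rw [← interior_eq_empty_iff_dense_compl, ← frontier_compl,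
      interior_frontier hW.isClosed_compl]
  filter_upwards [residual_of_dense_open isClosed_frontier.isOpen_compl hdense] with y hy hyV
  by_contra hyW
  exact hy (hW.frontier_eq ▸ ⟨hVW hyV, hyW⟩)

theorem eventually_residual_mem_imp_frequently_mem {P : ℕ → Set Y} (hP : ∀ n, IsOpen (P n))
    (hVP : ∀ N, V ⊆ closure (⋃ n ≥ N, P n)) :
    ∀ᶠ y in residual Y, y ∈ V → ∃ᶠ n in atTop, y ∈ P n := by
  have h := eventually_countable_forall.2 fun N =>
    eventually_residual_mem_imp_mem (isOpen_biUnion fun n (_ : n ≥ N) => hP n) (hVP N)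
  filter_upwards [h] with y hy hyV
  exact frequently_atTop.2 fun N =>
    let ⟨n, hNn, hn⟩ := Set.mem_iUnion₂.1 (hy N hyV)
    ⟨n, hNn, hn⟩

theorem mem_closure_of_forall_box {σ : Type*} [Finite σ] {X : Type*} [TopologicalSpace X]
    {x : σ → X} {S : Set (σ → X)} (h : ∀ u : σ → Set X, (∀ i, IsOpen (u i) ∧ x i ∈ u i) →
      ∃ y ∈ S, ∀ i, y i ∈ u i) : x ∈ closure S := by
  refine mem_closure_iff.2 fun O hO hx => ?_
  obtain ⟨u, hu, huO⟩ := isOpen_pi_iff'.1 hO x hx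
  obtain ⟨y, hyS, hyu⟩ := h u hu
  exact ⟨y, huO fun i _ => hyu i, hyS⟩

end Residual

theorem exists_mem_forall_lt_dist {X ι : Type*} [PseudoMetricSpace X] [Fintype ι] {S : Set X}
    (hS : IsPreconnected S) {u v : X} (hu : u ∈ S) (hv : v ∈ S) (w : ι → X) {ρ : ℝ}
    (hρ : Fintype.card ι * (2 * ρ) < dist u v) : ∃ c ∈ S, ∀ i, ρ < dist c (w i) := by
  by_contra! hcon
  have hcover : Set.Icc 0 (dist u v) ⊆ ⋃ i, Metric.closedBall (dist (w i) u) ρ := by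
    intro t ht
    obtain ⟨c, hc, rfl⟩ := (hS.image (dist · u) (by fun_prop)).ordConnected.out
      ⟨u, hu, dist_self u⟩ ⟨v, hv, dist_comm v u⟩ ht
    obtain ⟨i, hi⟩ := hcon c hc
    exact Set.mem_iUnion.2 ⟨i, (dist_dist_dist_le_left c (w i) u).trans hi⟩
  have hvolume := (MeasureTheory.measure_mono hcover).trans
    (MeasureTheory.measure_iUnion_fintype_le MeasureTheory.volume _)
  simp only [Real.volume_Icc, Real.volume_closedBall, Finset.sum_const, Finset.card_univ,
    sub_zero, nsmul_eq_mul, ← ENNReal.ofReal_natCast (Fintype.card ι),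
    ← ENNReal.ofReal_mul (Nat.cast_nonneg (Fintype.card ι))] at hvolume
  obtain ⟨i, hi⟩ := hcon u hu
  have hρ₀ : 0 ≤ ρ := dist_nonneg.trans hi
  exact hρ.not_ge ((ENNReal.ofReal_le_ofReal_iff (by positivity)).1 hvolume)

/-- Sensitivity to initial conditions localized to `V`: for every nonempty open subset `W` of `V`
and infinitely many `n`, two points of `W` have `n`-th iterates at distance at least `δ`. The two
points may depend on `n`. -/
def SensitiveOn {X : Type*} [PseudoMetricSpace X] (f : X → X) (V : Set X) (δ : ℝ) : Prop :=
  ∀ W ⊆ V, IsOpen W → W.Nonempty →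
    ∃ᶠ n in atTop, ∃ u ∈ W, ∃ v ∈ W, δ ≤ dist (f^[n] u) (f^[n] v)

section GenericTuples

variable {X : Type*} [PseudoMetricSpace X] {f : X → X} {z : X}

theorem exists_mem_tendsto_of_forall_not_sensitiveOn [BaireSpace X]
    (hz : ∀ W, IsOpen W → W.Nonempty → z ∈ lowerLimit f W) {U : Set X} (hU : IsOpen U)
    (hUne : U.Nonempty)
    (hU_not : ∀ V ⊆ U, IsOpen V → V.Nonempty → ∀ δ > 0, ¬SensitiveOn f V δ) :
    ∃ x ∈ U, Tendsto (fun n => f^[n] x) atTop (𝓝 z) := by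
  let G : ℕ → Set X := fun m =>
    ⋃₀ {W | IsOpen W ∧ ∀ᶠ n in atTop, ∀ u ∈ W, dist (f^[n] u) z < 1 / (m + 1)}
  have hUG : ∀ m, U ⊆ closure (G m) := by
    refine fun m x hx => mem_closure_iff.2 fun O hO hxO => ?_
    have hδ : (0 : ℝ) < 1 / (m + 1) / 2 := half_pos Nat.one_div_pos_of_nat
    have hnot := hU_not _ Set.inter_subset_left (hU.inter hO) ⟨x, hx, hxO⟩ _ hδ
    simp only [SensitiveOn, not_forall, not_frequently, not_exists, not_and, not_le] at hnot
    obtain ⟨W, hWsub, hW, ⟨w, hw⟩, hsmall⟩ := hnot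
    refine ⟨w, (hWsub hw).2, W, ⟨hW, ?_⟩, hw⟩
    filter_upwards [hsmall, hz W hW ⟨w, hw⟩ _ (Metric.ball_mem_nhds z hδ)]
      with n hn ⟨v, hv, hvz⟩ u hu
    linarith [dist_triangle (f^[n] u) (f^[n] v) z, hn u hu v hv, Metric.mem_ball.1 hvz]
  have hgeneric := eventually_countable_forall.2 fun m =>
    eventually_residual_mem_imp_mem (isOpen_sUnion fun W hW => hW.1) (hUG m)
  obtain ⟨x, hxU, hx⟩ := (dense_of_mem_residual hgeneric).inter_open_nonempty U hU hUne
  refine ⟨x, hxU, Metric.tendsto_nhds.2 fun ε hε => ?_⟩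
  obtain ⟨m, hm⟩ := exists_nat_one_div_lt hε
  obtain ⟨W, ⟨-, hW⟩, hxW⟩ := hx m hxU
  exact hW.mono fun n hn => (hn x hxW).trans hm

variable {σ : Type*} [Finite σ]

theorem eventually_residual_frequently_forall_dist_lt (hf : Continuous f)
    (hz : ∀ W, IsOpen W → W.Nonempty → z ∈ lowerLimit f W) :
    ∀ᶠ x : σ → X in residual (σ → X),
      ∀ ε > 0, ∃ᶠ n in atTop, ∀ i, dist (f^[n] (x i)) z < ε := by
  have hfixed : ∀ ε > 0, ∀ᶠ x : σ → X in residual (σ → X),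
      ∃ᶠ n in atTop, ∀ i, dist (f^[n] (x i)) z < ε := by
    intro ε hε
    have hopen : ∀ n, IsOpen {x : σ → X | ∀ i, dist (f^[n] (x i)) z < ε} := fun n => by
      simp only [Set.ofPred_forall]
      exact isOpen_iInter_of_finite fun i => isOpen_lt
        (((hf.iterate n).comp (continuous_apply i)).dist continuous_const) continuous_const
    refine (eventually_residual_mem_imp_frequently_mem (V := Set.univ) hopen
      fun N x _ => mem_closure_of_forall_box fun u hu => ?_).mono fun x hx => hx trivial
    obtain ⟨n, hn, hNn⟩ := ((eventually_all.2 fun i => hz (u i) (hu i).1 ⟨x i, (hu i).2⟩ _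
      (Metric.ball_mem_nhds z hε)).and (eventually_ge_atTop N)).exists
    choose y hyu hyz using hn
    exact ⟨y, Set.mem_iUnion₂.2 ⟨n, hNn, hyz⟩, hyu⟩
  filter_upwards [eventually_countable_forall.2 fun m : ℕ =>
    hfixed (1 / (m + 1)) Nat.one_div_pos_of_nat] with x hx ε hε
  obtain ⟨m, hm⟩ := exists_nat_one_div_lt hε
  exact (hx m).mono fun n hn i => (hn i).trans hm

theorem exists_eventually_residual_frequently_forall_ne_lt_dist [LocallyConnectedSpace X]
    (hf : Continuous f) {V : Set X} (hV : IsOpen V) {δ : ℝ} (hδ : 0 < δ)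
    (hsens : SensitiveOn f V δ) (i : σ) :
    ∃ r > 0, ∀ᶠ x : σ → X in residual (σ → X),
      x i ∈ V → ∃ᶠ n in atTop, ∀ j ≠ i, r < dist (f^[n] (x i)) (f^[n] (x j)) := by
  classical
  cases nonempty_fintype σ
  have hcard : (0 : ℝ) < Fintype.card σ := Nat.cast_pos.2 (Fintype.card_pos_iff.2 ⟨i⟩)
  set r := δ / (4 * Fintype.card σ)
  have hopen : ∀ n, IsOpen {x : σ → X | ∀ j ≠ i, r < dist (f^[n] (x i)) (f^[n] (x j))} := by
    intro n
    simp only [Set.ofPred_forall]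
    exact isOpen_iInter_of_finite fun j => isOpen_iInter_of_finite fun _ => isOpen_lt
      continuous_const (((hf.iterate n).comp (continuous_apply i)).dist
        ((hf.iterate n).comp (continuous_apply j)))
  refine ⟨r, by positivity, eventually_residual_mem_imp_frequently_mem (V := {x : σ → X | x i ∈ V})
    hopen fun N x hx => mem_closure_of_forall_box fun u hu => ?_⟩
  obtain ⟨W, hWsub, hWopen, hxW, hWconn⟩ :=
    locallyConnectedSpace_iff_subsets_isOpen_isConnected.1 ‹_› (x i) (V ∩ u i)
      ((hV.inter (hu i).1).mem_nhds ⟨hx, (hu i).2⟩)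
  obtain ⟨n, hNn, a, ha, b, hb, hab⟩ := frequently_atTop.1
    (hsens W (hWsub.trans Set.inter_subset_left) hWopen ⟨x i, hxW⟩) N
  obtain ⟨_, ⟨c, hc, rfl⟩, hsep⟩ := exists_mem_forall_lt_dist
    (hWconn.isPreconnected.image _ (hf.iterate n).continuousOn) (Set.mem_image_of_mem _ ha)
    (Set.mem_image_of_mem _ hb) (fun j => f^[n] (x j)) (ρ := r) <| by
      refine lt_of_lt_of_le ?_ hab
      rw [show r = δ / (4 * Fintype.card σ) from rfl]
      field_simp
      linarith
  refine ⟨Function.update x i c, Set.mem_iUnion₂.2 ⟨n, hNn, fun j hj => ?_⟩, fun j => ?_⟩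
  · simpa only [Function.update_self, Function.update_of_ne hj] using hsep j
  · rcases eq_or_ne j i with rfl | hj
    · simpa only [Function.update_self] using (hWsub hc).2
    · simpa only [Function.update_of_ne hj] using (hu j).2

end GenericTuples

section Hyperspace

variable {X : Type*} [MetricSpace X]

theorem exists_mem_dist_le_of_mem {K L : NonemptyCompacts X} {a : X} (ha : a ∈ K) :
    ∃ b ∈ L, dist a b ≤ dist K L := by
  obtain ⟨b, hb, hab⟩ := L.isCompact.exists_infDist_eq_dist L.nonempty a
  exact ⟨b, hb, hab ▸ Metric.infDist_le_hausdorffDist_of_mem ha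
    (Metric.hausdorffEDist_ne_top_of_nonempty_of_bounded K.nonempty L.nonempty
      K.isCompact.isBounded L.isCompact.isBounded)⟩

theorem dist_sup_sup_le (K K' L L' : NonemptyCompacts X) :
    dist (K ⊔ L) (K' ⊔ L') ≤ max (dist K K') (dist L L') := by
  simpa only [NNReal.coe_one, one_mul, Prod.dist_eq] using
    NonemptyCompacts.lipschitz_sup.dist_le_mul (K, L) (K', L')

theorem dist_le_two_mul_dist_singleton_sup (z a b : X) :
    dist a b ≤ 2 * dist ({z} ⊔ {a} : NonemptyCompacts X) ({z} ⊔ {b}) := by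
  have hmem : ∀ {u v : X}, u ∈ ({z} ⊔ {v} : NonemptyCompacts X) ↔ u = z ∨ u = v := Iff.rfl
  obtain ⟨u, hu, hau⟩ := exists_mem_dist_le_of_mem (L := {z} ⊔ {b}) (hmem.2 (.inr (rfl : a = a)))
  obtain ⟨v, hv, hbv⟩ := exists_mem_dist_le_of_mem (L := {z} ⊔ {a}) (hmem.2 (.inr (rfl : b = b)))
  rw [dist_comm ({z} ⊔ {b} : NonemptyCompacts X)] at hbv
  rcases hmem.1 hu with rfl | rfl
  · rcases hmem.1 hv with rfl | rfl
    · linarith [dist_triangle_right a b v]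
    · linarith [dist_comm b v, dist_nonneg (x := b) (y := v)]
  · linarith [dist_nonneg (x := a) (y := u)]

/-- The range of a nonempty finite tuple, as a point of the hyperspace: finite compact sets are
handled as tuples, so that category arguments can be carried out in the power `ι → X`. -/
def rangeCompacts {ι : Type*} [Finite ι] [Nonempty ι] (x : ι → X) : NonemptyCompacts X :=
  ⟨⟨Set.range x, (Set.finite_range x).isCompact⟩, Set.range_nonempty x⟩

variable {ι : Type*} [Finite ι] [Nonempty ι]

theorem dist_rangeCompacts_le {x y : ι → X} {ε : ℝ} (h : ∀ i, dist (x i) (y i) ≤ ε) :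
    dist (rangeCompacts x) (rangeCompacts y) ≤ ε :=
  Metric.hausdorffDist_le_of_mem_dist (dist_nonneg.trans (h (Classical.arbitrary ι)))
    (Set.forall_mem_range.2 fun i => ⟨y i, Set.mem_range_self i, h i⟩)
    (Set.forall_mem_range.2 fun i => ⟨x i, Set.mem_range_self i, dist_comm (x i) (y i) ▸ h i⟩)

theorem dist_rangeCompacts_singleton_le {x : ι → X} {z : X} {ε : ℝ} (h : ∀ i, dist (x i) z ≤ ε) :
    dist (rangeCompacts x) {z} ≤ ε := by
  have hconst : rangeCompacts (fun _ : ι => z) = {z} := NonemptyCompacts.ext Set.range_const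
  exact hconst ▸ dist_rangeCompacts_le h

theorem rangeCompacts_coe (K : NonemptyCompacts X) [Finite (K : Set X)] [Nonempty (K : Set X)] :
    rangeCompacts ((↑) : ↥(K : Set X) → X) = K :=
  NonemptyCompacts.ext Subtype.range_coe

theorem rangeCompacts_sup_singleton (x : ι → X) (i : ι) :
    rangeCompacts x ⊔ {x i} = rangeCompacts x :=
  sup_eq_left.2 (Set.singleton_subset_iff.2 (Set.mem_range_self i))

theorem exists_dist_le_dist_rangeCompacts {κ : Type*} [Finite κ] [Nonempty κ] (x : ι → X)
    (y : κ → X) (i : ι) : ∃ j, dist (x i) (y j) ≤ dist (rangeCompacts x) (rangeCompacts y) := by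
  obtain ⟨_, ⟨j, rfl⟩, hj⟩ := exists_mem_dist_le_of_mem (K := rangeCompacts x)
    (L := rangeCompacts y) (Set.mem_range_self i)
  exact ⟨j, hj⟩

end Hyperspace

section InducedMap

variable {X : Type*} [MetricSpace X] [CompactSpace X] {f : C(X, X)}

theorem coe_iterate_inducedMap (n : ℕ) (K : NonemptyCompacts X) :
    (((inducedMap f)^[n] K : NonemptyCompacts X) : Set X) = f^[n] '' K := by
  induction n with
  | zero => exact (Set.image_id _).symm
  | succ n ih =>
    rw [Function.iterate_succ_apply', Function.iterate_succ', Set.image_comp, ← ih]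
    rfl

theorem iterate_inducedMap_sup_singleton (n : ℕ) (K : NonemptyCompacts X) (a : X) :
    (inducedMap f)^[n] (K ⊔ {a}) = (inducedMap f)^[n] K ⊔ {f^[n] a} :=
  NonemptyCompacts.ext <| by
    simp only [coe_iterate_inducedMap, NonemptyCompacts.coe_sup, NonemptyCompacts.coe_singleton,
      Set.image_union, Set.image_singleton]

theorem sup_singleton_mem_liYorkePairs {K L : NonemptyCompacts X} {z a b : X}
    (hK : Tendsto (fun n => (inducedMap f)^[n] K) atTop (𝓝 {z}))
    (hL : Tendsto (fun n => (inducedMap f)^[n] L) atTop (𝓝 {z}))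
    (hab : (a, b) ∈ liYorkePairs f) : (K ⊔ {a}, L ⊔ {b}) ∈ liYorkePairs (inducedMap f) := by
  have hclose : ∀ ε > 0, ∀ᶠ n in atTop, dist ((inducedMap f)^[n] K) {z} < ε ∧
      dist ((inducedMap f)^[n] L) {z} < ε := fun ε hε =>
    (Metric.tendsto_nhds.1 hK ε hε).and (Metric.tendsto_nhds.1 hL ε hε)
  constructor
  · refine mem_proximalPairs_iff.2 fun ε hε => ?_
    refine ((mem_proximalPairs_iff.1 hab.1 ε hε).and_eventually
      (hclose (ε / 2) (half_pos hε))).mono fun n ⟨hn, hKn, hLn⟩ => ?_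
    simp only [iterate_inducedMap_sup_singleton]
    refine (dist_sup_sup_le ..).trans_lt (max_lt ?_ ?_)
    · linarith [hKn, hLn, dist_triangle_right ((inducedMap f)^[n] K) ((inducedMap f)^[n] L) {z}]
    · rwa [NonemptyCompacts.isometry_singleton.dist_eq]
  · obtain ⟨ε, hε, hfar⟩ := mem_nonAsymptoticPairs_iff.1 hab.2
    refine mem_nonAsymptoticPairs_iff.2 ⟨ε / 4, by positivity, ?_⟩
    refine (hfar.and_eventually (hclose (ε / 8) (by positivity))).mono
      fun n ⟨hn, hKn, hLn⟩ => ?_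
    simp only [iterate_inducedMap_sup_singleton]
    have hreplace : ∀ (M : NonemptyCompacts X) (c : X),
        dist (M ⊔ {c}) ({z} ⊔ {c}) ≤ dist M {z} := fun M c =>
      (dist_sup_sup_le ..).trans (by rw [dist_self, max_eq_left dist_nonneg])
    have hKz := hreplace ((inducedMap f)^[n] K) (f^[n] a)
    have hLz := hreplace ((inducedMap f)^[n] L) (f^[n] b)
    rw [dist_comm] at hKz
    linarith [hn, hKn, hLn, dist_le_two_mul_dist_singleton_sup z (f^[n] a) (f^[n] b),
      dist_triangle4 ({z} ⊔ {f^[n] a}) ((inducedMap f)^[n] K ⊔ {f^[n] a})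
        ((inducedMap f)^[n] L ⊔ {f^[n] b}) ({z} ⊔ {f^[n] b})]

variable {ι κ : Type*} [Finite ι] [Nonempty ι] [Finite κ] [Nonempty κ]

theorem iterate_inducedMap_rangeCompacts (n : ℕ) (x : ι → X) :
    (inducedMap f)^[n] (rangeCompacts x) = rangeCompacts fun i => f^[n] (x i) :=
  NonemptyCompacts.ext <| (coe_iterate_inducedMap n _).trans (Set.range_comp _ _).symm

theorem tendsto_iterate_inducedMap_rangeCompacts {x : ι → X} {z : X}
    (hx : ∀ i, Tendsto (fun n => f^[n] (x i)) atTop (𝓝 z)) :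
    Tendsto (fun n => (inducedMap f)^[n] (rangeCompacts x)) atTop (𝓝 {z}) := by
  refine Metric.tendsto_nhds.2 fun ε hε => ?_
  filter_upwards [eventually_all.2 fun i => Metric.tendsto_nhds.1 (hx i) (ε / 2) (half_pos hε)]
    with n hn
  rw [iterate_inducedMap_rangeCompacts]
  exact (dist_rangeCompacts_singleton_le fun i => (hn i).le).trans_lt (half_lt_self hε)

theorem rangeCompacts_mem_proximalPairs {x : ι ⊕ κ → X} {z : X}
    (hx : ∀ ε > 0, ∃ᶠ n in atTop, ∀ i, dist (f^[n] (x i)) z < ε) :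
    (rangeCompacts (x ∘ Sum.inl), rangeCompacts (x ∘ Sum.inr)) ∈ proximalPairs (inducedMap f) := by
  refine mem_proximalPairs_iff.2 fun ε hε => (hx (ε / 3) (by positivity)).mono fun n hn => ?_
  simp only [iterate_inducedMap_rangeCompacts]
  have hι := dist_rangeCompacts_singleton_le fun i : ι => (hn (.inl i)).le
  have hκ := dist_rangeCompacts_singleton_le fun j : κ => (hn (.inr j)).le
  exact (dist_triangle_right _ _ {z}).trans_lt <| (add_le_add hι hκ).trans_lt (by linarith)

theorem rangeCompacts_mem_nonAsymptoticPairs {x : ι ⊕ κ → X} {r : ℝ} (hr : 0 < r) (i : ι ⊕ κ)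
    (hx : ∃ᶠ n in atTop, ∀ j ≠ i, r < dist (f^[n] (x i)) (f^[n] (x j))) :
    (rangeCompacts (x ∘ Sum.inl), rangeCompacts (x ∘ Sum.inr)) ∈
      nonAsymptoticPairs (inducedMap f) := by
  refine mem_nonAsymptoticPairs_iff.2 ⟨r, hr, hx.mono fun n hn => ?_⟩
  simp only [iterate_inducedMap_rangeCompacts]
  rcases i with i | i
  · obtain ⟨j, hj⟩ := exists_dist_le_dist_rangeCompacts
      (fun i : ι => f^[n] (x (.inl i))) (fun j : κ => f^[n] (x (.inr j))) i
    exact (hn (.inr j) Sum.inr_ne_inl).trans_le hj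
  · obtain ⟨j, hj⟩ := exists_dist_le_dist_rangeCompacts
      (fun j : κ => f^[n] (x (.inr j))) (fun i : ι => f^[n] (x (.inl i))) i
    exact (hn (.inl j) Sum.inl_ne_inr).trans_le (hj.trans_eq (dist_comm _ _))

end InducedMap

section Continuum

variable {X : Type*} [TopologicalSpace X]

theorem locallyConnectedSpace_of_orderTopology [ConditionallyCompleteLinearOrder X]
    [OrderTopology X] [DenselyOrdered X] : LocallyConnectedSpace X :=
  locallyConnectedSpace_iff_connected_subsets.2 fun x U hU =>
    ⟨Set.ordConnectedComponent U x, Set.ordConnectedComponent_mem_nhds.2 hU,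
      Set.OrdConnected.isPreconnected inferInstance, Set.ordConnectedComponent_subset⟩

theorem exists_isNondegenerateInterval_subset [ConditionallyCompleteLinearOrder X]
    [OrderTopology X] [DenselyOrdered X] [Nontrivial X] {W : Set X} (hW : IsOpen W)
    (hWne : W.Nonempty) : ∃ J ⊆ W, IsNondegenerateInterval J :=
  let ⟨_, _, hab, hJW⟩ := hW.exists_Ioo_subset hWne
  ⟨_, hJW, isPreconnected_Ioo, (Set.Ioo_infinite hab).nontrivial⟩

end Continuum

section Criterion

variable {X : Type*} [MetricSpace X] [CompactSpace X] {f : C(X, X)} {z : X}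
  {ι κ : Type*} [Finite ι] [Nonempty ι] [Finite κ] [Nonempty κ] {c : ι ⊕ κ → X} {ε : ℝ}

theorem exists_rangeCompacts_mem_liYorkePairs_of_sensitiveOn [LocallyConnectedSpace X]
    (hz : ∀ W, IsOpen W → W.Nonempty → z ∈ lowerLimit f W) {i : ι ⊕ κ} {V : Set X}
    (hVc : V ⊆ Metric.ball (c i) ε) (hV : IsOpen V) (hVne : V.Nonempty) {δ : ℝ} (hδ : 0 < δ)
    (hsens : SensitiveOn f V δ) :
    ∃ x : ι ⊕ κ → X, (∀ j, dist (x j) (c j) < ε) ∧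
      (rangeCompacts (x ∘ Sum.inl), rangeCompacts (x ∘ Sum.inr)) ∈
        liYorkePairs (inducedMap f) := by
  classical
  obtain ⟨v, hv⟩ := hVne
  obtain ⟨r, hr, hseparated⟩ := exists_eventually_residual_frequently_forall_ne_lt_dist
    f.continuous hV hδ hsens i
  have hgeneric := (eventually_residual_frequently_forall_dist_lt f.continuous hz).and hseparated
  have hopen : IsOpen {x : ι ⊕ κ → X | x i ∈ V ∧ ∀ j, x j ∈ Metric.ball (c j) ε} := by
    rw [Set.ofPred_and, Set.ofPred_forall]
    exact (hV.preimage (continuous_apply i)).inter <|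
      isOpen_iInter_of_finite fun j => Metric.isOpen_ball.preimage (continuous_apply j)
  have hne : {x : ι ⊕ κ → X | x i ∈ V ∧ ∀ j, x j ∈ Metric.ball (c j) ε}.Nonempty := by
    refine ⟨Function.update c i v, by simpa only [Function.update_self] using hv, fun j => ?_⟩
    rcases eq_or_ne j i with rfl | hj
    · simpa only [Function.update_self] using hVc hv
    · simpa only [Function.update_of_ne hj] using
        Metric.mem_ball_self (dist_nonneg.trans_lt (hVc hv))
  obtain ⟨x, ⟨hxV, hxc⟩, hproximal, hfar⟩ :=
    (dense_of_mem_residual hgeneric).inter_open_nonempty _ hopen hne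
  exact ⟨x, hxc, rangeCompacts_mem_proximalPairs hproximal,
    rangeCompacts_mem_nonAsymptoticPairs hr i (hfar hxV)⟩

theorem DenselyChaotic.exists_mem_liYorkePairs_inducedMap_of_forall_not_sensitiveOn
    (hf : DenselyChaotic f) (hz : ∀ W, IsOpen W → W.Nonempty → z ∈ lowerLimit f W) (hε : 0 < ε)
    (hnot : ∀ i, ∀ V ⊆ Metric.ball (c i) ε, IsOpen V → V.Nonempty → ∀ δ > 0, ¬SensitiveOn f V δ) :
    ∃ q ∈ liYorkePairs (inducedMap f), dist q.1 (rangeCompacts (c ∘ Sum.inl)) ≤ ε ∧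
      dist q.2 (rangeCompacts (c ∘ Sum.inr)) ≤ ε := by
  have hne : ∀ i, (Metric.ball (c i) ε).Nonempty := fun i => Metric.nonempty_ball.2 hε
  choose x hxc hxz using fun i =>
    exists_mem_tendsto_of_forall_not_sensitiveOn hz Metric.isOpen_ball (hne i) (hnot i)
  let i : ι := Classical.arbitrary ι
  let j : κ := Classical.arbitrary κ
  obtain ⟨⟨a, b⟩, ⟨ha, hb⟩, hab⟩ := hf.inter_open_nonempty _
    (Metric.isOpen_ball.prod Metric.isOpen_ball) ((hne (.inl i)).prod (hne (.inr j)))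
  refine ⟨_, sup_singleton_mem_liYorkePairs
    (tendsto_iterate_inducedMap_rangeCompacts fun i : ι => hxz (.inl i))
    (tendsto_iterate_inducedMap_rangeCompacts fun j : κ => hxz (.inr j)) hab, ?_, ?_⟩
  · rw [← rangeCompacts_sup_singleton (c ∘ Sum.inl) i]
    exact (dist_sup_sup_le ..).trans <| max_le (dist_rangeCompacts_le fun i => (hxc (.inl i)).le)
      ((NonemptyCompacts.isometry_singleton.dist_eq ..).trans_le (le_of_lt ha))
  · rw [← rangeCompacts_sup_singleton (c ∘ Sum.inr) j]
    exact (dist_sup_sup_le ..).trans <| max_le (dist_rangeCompacts_le fun j => (hxc (.inr j)).le)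
      ((NonemptyCompacts.isometry_singleton.dist_eq ..).trans_le (le_of_lt hb))

theorem DenselyChaotic.exists_mem_liYorkePairs_inducedMap [LocallyConnectedSpace X]
    (hf : DenselyChaotic f) (hz : ∀ W, IsOpen W → W.Nonempty → z ∈ lowerLimit f W)
    (c : ι ⊕ κ → X) (hε : 0 < ε) :
    ∃ q ∈ liYorkePairs (inducedMap f), dist q.1 (rangeCompacts (c ∘ Sum.inl)) ≤ ε ∧
      dist q.2 (rangeCompacts (c ∘ Sum.inr)) ≤ ε := by
  by_cases! h : ∃ i, ∃ V ⊆ Metric.ball (c i) ε, IsOpen V ∧ V.Nonempty ∧ ∃ δ > 0, SensitiveOn f V δ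
  · obtain ⟨i, V, hVc, hV, hVne, δ, hδ, hsens⟩ := h
    obtain ⟨x, hxc, hx⟩ :=
      exists_rangeCompacts_mem_liYorkePairs_of_sensitiveOn hz hVc hV hVne hδ hsens
    exact ⟨_, hx, dist_rangeCompacts_le fun i => (hxc (.inl i)).le,
      dist_rangeCompacts_le fun j => (hxc (.inr j)).le⟩
  · exact hf.exists_mem_liYorkePairs_inducedMap_of_forall_not_sensitiveOn hz hε h

theorem DenselyChaotic.inducedMap_of_forall_mem_lowerLimit [LocallyConnectedSpace X]
    (hf : DenselyChaotic f) (hz : ∀ W, IsOpen W → W.Nonempty → z ∈ lowerLimit f W) :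
    DenselyChaotic (inducedMap f) := by
  refine ((NonemptyCompacts.dense_setOfPred_finite.prod
    NonemptyCompacts.dense_setOfPred_finite).mono ?_).of_closure
  rintro ⟨K, L⟩ ⟨hK, hL⟩
  refine Metric.mem_closure_iff.2 fun ε hε => ?_
  have : Finite (K : Set X) := hK
  have : Finite (L : Set X) := hL
  have : Nonempty (K : Set X) := K.nonempty.to_subtype
  have : Nonempty (L : Set X) := L.nonempty.to_subtype
  obtain ⟨q, hq, hqK, hqL⟩ := hf.exists_mem_liYorkePairs_inducedMap hz
    (Sum.elim ((↑) : ↥(K : Set X) → X) ((↑) : ↥(L : Set X) → X)) (half_pos hε)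
  rw [Sum.elim_comp_inl, rangeCompacts_coe, dist_comm] at hqK
  rw [Sum.elim_comp_inr, rangeCompacts_coe, dist_comm] at hqL
  exact ⟨q, hq, max_lt (hqK.trans_lt (half_lt_self hε)) (hqL.trans_lt (half_lt_self hε))⟩

end Criterion

theorem theorem4p1_general {X : Type*} [CompleteLinearOrder X] [MetricSpace X] [OrderTopology X]
    [DenselyOrdered X] (f : C(X, X)) (hf : DenselyChaotic f) : DenselyChaotic (inducedMap f) := by
  obtain ⟨z, -, hz⟩ := hf.exists_isFixedPt_forall_mem_lowerLimit
  have : LocallyConnectedSpace X := locallyConnectedSpace_of_orderTopology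
  have : Nontrivial X := hf.nontrivial
  refine hf.inducedMap_of_forall_mem_lowerLimit (z := z) fun W hW hWne => ?_
  obtain ⟨J, hJW, hJ⟩ := exists_isNondegenerateInterval_subset hW hWne
  exact lowerLimit_mono hJW (hz J hJ)

theorem theorem4p1 (f : C(unitInterval, unitInterval)) (hf : DenselyChaotic f) :
    DenselyChaotic (inducedMap f) :=
  theorem4p1_general f hf
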